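/- Modal formulas are built from propositional variables $p_0,p_1,\dots$ and $\bot$ by implication $\to$ and a binary modality $\rhd$; the connectives $\neg,\vee,\top$ are defined as usual by $\neg\phi=\phi\to\bot$, $\phi\vee\psi=\neg\phi\to\psi$, $\top=\neg\bot$. **Enumerations.** Let $U$ be an effectively coded set (for example, all words in a finite alphabet). A nondeterministic partial recursive function on $U$ is a map $f$ from $U$ to subsets of $U$ whose graph $\{(x,y): y\in f(x)\}$ is recursively enumerable ($f(x)$ is the set of values that a nondeterministic machine can return on input $x$). An *enumeration of nondeterministic partial recursive functions* is an acceptable (Gödel) enumeration $\{\xi_u\}_{u\in U}$ of all of them: $\{(u,x,y): y\in\xi_u(x)\}$ is recursively enumerable, every nondeterministic partial recursive function on $U$ is some $\xi_u$, and for every $n\ge 0$ and every family $\{\eta_z\}_{z\in U^n}$ of functions from $U$ to subsets of $U$ with $\{(z,x,y): y\in\eta_z(x)\}$ recursively enumerable there is a total recursive $s:U^n\to U$ with $\xi_{s(z)}=\eta_z$ for all $z\in U^n$. **Set semantics.** A valuation $*$ assigns to each variable a subset of $U$, and is extended to all formulas by $\bot^*=\varnothing$, $(\phi\to\psi)^*=(U\setminus\phi^*)\cup\psi^*$,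 and $$(\phi\rhd\psi)^*=\{w\in U : \forall u\in\phi^*\,(\xi_w(u)\ne\varnothing\Rightarrow\xi_w(u)\cap\psi^*\neq\varnothing)\}.$$ The formula $\phi$ is a tautology of $\{\xi_u\}_{u\in U}$ if $\phi^*=U$ for every valuation $*$. **Kripke models.** A Kripke model consists of a finite set $W$ of worlds, a ternary relation $u\to_w v$ on $W$, and a relation $\Vdash$ between worlds and propositional variables. Forcing is extended to all formulas: $w\nVdash\bot$; $w\Vdash\phi\to\psi$ iff $w\nVdash\phi$ or $w\Vdash\psi$; and $w\Vdash\phi\rhd\psi$ iff for all worlds $u,v$ with $u\to_w v$ and $u\Vdash\phi$ there is a world $v'$ with $u\to_w v'$ and $v'\Vdash\psi$. **The logic $\Re$.** $\Re$ extends classical propositional logic (in this language, with Modus Ponens) by the axioms - A1: $\phi\rhd\psi\to(\chi\rhd\psi\to(\phi\vee\chi)\rhd\psi)$, - A2: $\bot\rhd\phi$, - A3: $\phi\rhd\top$, and the monotonicity rule M: from $\phi_1\to\phi_2$ and $\psi_1\to\psi_2$ infer $\phi_2\rhd\psi_1\to\phi_1\rhd\psi_2$. **Theorem.** For every modal formula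 $\phi$ and every enumeration $\{\xi_u\}_{u\in U}$ of nondeterministic partial recursive functions in the above sense, the following are equivalent: 1. $\phi$ is a tautology of $\{\xi_u\}_{u\in U}$; 2. $w\Vdash\phi$ for every world $w$ of every Kripke model; 3. $\phi$ is provable in $\Re$. -/

import Mathlib

/-! ### Nondeterministic partial recursive functions and their enumerations -/

/-- A nondeterministic function from `U` to `U` assigns to an input the set of all values that it
can return there (the empty set where it diverges). It is partial recursive when its graph is
recursively enumerable, that is, when some nondeterministic machine can return `y` on input `x`
exactly if `y ∈ f x`. -/
def IsNondetPartialRecursive {U : Type*} [Primcodable U] (f : U → Set U) : Prop :=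
  REPred fun p : U × U => p.2 ∈ f p.1

/-- A family of nondeterministic partial recursive functions that are computed by one
nondeterministic machine from the parameter and the argument. -/
def IsUniformlyNondetPartialRecursive {P U : Type*} [Primcodable P] [Primcodable U]
    (η : P → U → Set U) : Prop :=
  REPred fun p : P × U × U => p.2.2 ∈ η p.1 p.2.1

/-- An acceptable (Gödel) enumeration of all nondeterministic partial recursive functions from
`U` to `U` by the elements of `U`. -/
structure IsNondetEnumeration {U : Type*} [Primcodable U] (ξ : U → U → Set U) : Prop where
  /-- there is a universal nondeterministic machine -/
  universal : IsUniformlyNondetPartialRecursive ξ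
  /-- every nondeterministic partial recursive function is listed -/
  exhaustive : ∀ f : U → Set U, IsNondetPartialRecursive f → ∃ u, ξ u = f
  /-- the parameter (s-m-n) property -/
  smn : ∀ (n : ℕ) (η : (Fin n → U) → U → Set U), IsUniformlyNondetPartialRecursive η →
    ∃ s : (Fin n → U) → U, Computable s ∧ ∀ z, ξ (s z) = η z

/-! ### The modal language -/

/-- Modal formulas: propositional variables (numbered by `ℕ`), falsum, implication, and the binary
modality `φ ▷ ψ`. -/
inductive ModalFormula : Type
  | var : ℕ → ModalFormula
  | bot : ModalFormula
  | imp : ModalFormula → ModalFormula → ModalFormula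
  | rhd : ModalFormula → ModalFormula → ModalFormula

namespace ModalFormula

/-- negation -/
def neg (φ : ModalFormula) : ModalFormula := imp φ bot

/-- the constant true -/
def top : ModalFormula := neg bot

/-- disjunction -/
def or (φ ψ : ModalFormula) : ModalFormula := imp (neg φ) ψ

/-- The set semantics: the extension of a valuation of the variables by subsets of `U` to all
formulas, where `u` is read as a code of the function `ξ u`. -/
def interp {U : Type*} (ξ : U → U → Set U) (V : ℕ → Set U) : ModalFormula → Set U
  | var p => V p
  | bot => ∅
  | imp φ ψ => (interp ξ V φ)ᶜ ∪ interp ξ V ψ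
  | rhd φ ψ =>
      {w | ∀ u ∈ interp ξ V φ, (ξ w u).Nonempty → (ξ w u ∩ interp ξ V ψ).Nonempty}

/-- `φ` is a tautology of `ξ`: it denotes the whole universe under every valuation. -/
def IsTautologyOf {U : Type*} (ξ : U → U → Set U) (φ : ModalFormula) : Prop :=
  ∀ V : ℕ → Set U, interp ξ V φ = Set.univ

/-- Provability in the logic `ℜ`: classical propositional logic (in the first three axiom schemes
and modus ponens), the axioms A1, A2, A3 and the monotonicity rule M. -/
inductive Provable : ModalFormula → Prop
  | impK (φ ψ : ModalFormula) : Provable (imp φ (imp ψ φ))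
  | impS (φ ψ χ : ModalFormula) :
      Provable (imp (imp φ (imp ψ χ)) (imp (imp φ ψ) (imp φ χ)))
  | dne (φ : ModalFormula) : Provable (imp (neg (neg φ)) φ)
  | a1 (φ ψ χ : ModalFormula) :
      Provable (imp (rhd φ ψ) (imp (rhd χ ψ) (rhd (or φ χ) ψ)))
  | a2 (φ : ModalFormula) : Provable (rhd bot φ)
  | a3 (φ : ModalFormula) : Provable (rhd φ top)
  | mp {φ ψ : ModalFormula} : Provable (imp φ ψ) → Provable φ → Provable ψ
  | mono {φ₁ φ₂ ψ₁ ψ₂ : ModalFormula} : Provable (imp φ₁ φ₂) → Provable (imp ψ₁ ψ₂) →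
      Provable (imp (rhd φ₂ ψ₁) (rhd φ₁ ψ₂))

end ModalFormula

/-! ### Kripke models -/

/-- A Kripke model: a finite set of worlds, a ternary computability relation, and a forcing
relation between worlds and propositional variables. -/
structure KripkeModel : Type 1 where
  /-- the worlds -/
  World : Type
  finite_world : Finite World
  /-- `step w u v` stands for `u →_w v` -/
  step : World → World → World → Prop
  /-- forcing of the propositional variables -/
  forcesVar : World → ℕ → Prop

namespace KripkeModel

/-- The forcing relation between worlds and modal formulas. -/
def Forces (K : KripkeModel) : K.World → ModalFormula → Prop
  | w, .var p => K.forcesVar w p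
  | _, .bot => False
  | w, .imp φ ψ => ¬ K.Forces w φ ∨ K.Forces w ψ
  | w, .rhd φ ψ => ∀ u v, K.step w u v → K.Forces u φ →
      ∃ v', K.step w u v' ∧ K.Forces v' ψ

end KripkeModel

/-! ### Closure properties of recursively enumerable predicates -/

namespace REPred

variable {α β : Type*} [Primcodable α] [Primcodable β]

/-! Soundness (3 to 1) is induction on derivations and uses nothing about `ξ`.

For 1 to 2, a finite Kripke model is copied into `U`. The recursion theorem gives distinct programs,
one per world, such that the program of `w` on the program of `u` returns exactly the programs of
those `v` with `step w u v`, and diverges on every other input (`exists_realization`). Elements of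
`U` that code no world are therefore invisible to the modality at codes, and a code lies in the
interpretation of a formula iff its world forces it.

For 2 to 3, a finite canonical model is built from traces of maximal consistent sets on the
subformulas of `θ`. If `φ ▷ ψ` is not in `M`, the `χ` with `χ ▷ ψ` in `M` form an ideal by A1 and
A2, and M yields a maximal consistent `N` that contains `φ` and misses this ideal
(`exists_of_rhd_notMem`). On input `N` the world `M` must return values, all avoiding `ψ`. Since the
formula to avoid is not determined by `N`, each world carries one as a label. -/

theorem comp {p : β → Prop} (hp : REPred p) {f : α → β} (hf : Computable f) :
    REPred fun a => p (f a) :=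
  Partrec.comp (f := fun b => Part.assert (p b) fun _ => Part.some ()) hp hf

theorem and {p q : α → Prop} (hp : REPred p) (hq : REPred q) : REPred fun a => p a ∧ q a := by
  have h : Partrec fun a : α => (Part.assert (p a) fun _ => Part.some ()).bind fun _ =>
      Part.assert (q a) fun _ => Part.some () :=
    Partrec.bind hp (Partrec.comp hq Computable.fst).to₂
  refine h.dom_re.of_eq fun a => ?_
  simp [Part.dom_iff_mem]

/-- Recursively enumerable predicates are the projections of computable relations. -/
theorem exists_computable {p : α → Prop} (hp : REPred p) :
    ∃ g : α → ℕ → Option ℕ, Computable₂ g ∧ ∀ a, p a ↔ ∃ k x, x ∈ g a k := by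
  obtain ⟨c, hc⟩ := Nat.Partrec.Code.exists_code.1 (Partrec.bind_decode₂_iff.1 hp)
  refine ⟨fun a k => c.evaln k (Encodable.encode a), ?_, fun a => ?_⟩
  · exact Nat.Partrec.Code.primrec_evaln.to_comp.comp
      ((Computable.snd.pair (Computable.const c)).pair (Computable.encode.comp Computable.fst))
  · have h : p a ↔ (c.eval (Encodable.encode a)).Dom := by
      rw [hc]
      simp [Part.dom_iff_mem]
    rw [h, Part.dom_iff_mem, exists_comm]
    simp only [Nat.Partrec.Code.evaln_complete]

theorem exists_right {p : α → β → Prop} (hp : REPred fun x : α × β => p x.1 x.2) :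
    REPred fun a => ∃ b, p a b := by
  obtain ⟨g, hg, hpg⟩ := exists_computable hp
  -- Dovetailing: `m` codes a candidate `b` together with a stage of the search.
  have h : Partrec fun a : α => Nat.rfindOpt fun m : ℕ =>
      (Encodable.decode (α := β) m.unpair.1).bind fun b => g (a, b) m.unpair.2 := by
    refine Partrec.rfindOpt (Computable.option_bind ?_ ?_)
    · exact Computable.decode.comp
        (Computable.fst.comp (Primrec.unpair.to_comp.comp Computable.snd))
    · exact hg.comp ((Computable.fst.comp Computable.fst).pair Computable.snd)
        (Computable.snd.comp (Primrec.unpair.to_comp.comp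
          (Computable.snd.comp Computable.fst)))
  refine h.dom_re.of_eq fun a => ?_
  rw [Nat.rfindOpt_dom]
  constructor
  · rintro ⟨m, x, hx⟩
    obtain ⟨b, -, hb⟩ := Option.mem_bind_iff.1 hx
    exact ⟨b, (hpg (a, b)).2 ⟨_, x, hb⟩⟩
  · rintro ⟨b, hb⟩
    obtain ⟨k, x, hx⟩ := (hpg (a, b)).1 hb
    exact ⟨Nat.pair (Encodable.encode b) k, x, by simpa using hx⟩

end REPred

/-! ### Primitive recursion over finite types -/

namespace PrimrecPred

variable {α : Type*} [Primcodable α]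

theorem exists_fin {n : ℕ} {p : α → Fin n → Prop}
    (hp : PrimrecPred fun x : α × Fin n => p x.1 x.2) :
    PrimrecPred fun a => ∃ i, p a i := by
  have h : PrimrecRel fun (i : Fin n) (a : α) => p a i :=
    (hp.comp (Primrec.snd.pair Primrec.fst) : PrimrecPred fun x : Fin n × α => p x.2 x.1)
  exact (h.exists_mem_list.comp (Primrec.const (List.finRange n)) Primrec.id).of_eq (by simp)

theorem forall_fin {n : ℕ} {p : α → Fin n → Prop}
    (hp : PrimrecPred fun x : α × Fin n => p x.1 x.2) :
    PrimrecPred fun a => ∀ i, p a i :=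
  (hp.not.exists_fin (p := fun a i => ¬ p a i)).not.of_eq (by simp)

theorem of_finite [Finite α] (p : α → Prop) : PrimrecPred p := by
  classical
  exact ⟨inferInstance, Primrec.dom_finite _⟩

end PrimrecPred

theorem Computable.fin_pi {α β : Type*} [Primcodable α] [Primcodable β] {n : ℕ}
    {f : Fin n → α → β} (hf : ∀ i, Computable (f i)) : Computable fun a i => f i a := by
  have h : Computable fun v : List.Vector β n => v.get :=
    (Primrec.fin_curry.2 Primrec.vector_get).to_comp
  exact (h.comp (Computable.vector_ofFn hf)).of_eq fun a => by
    funext i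
    simp

/-! ### Recursion theorems for enumerations of nondeterministic partial recursive functions -/

theorem isUniformlyNondetPartialRecursive_singleton {P U : Type*} [Primcodable P] [Primcodable U]
    {f : P → U → U} (hf : Computable₂ f) :
    IsUniformlyNondetPartialRecursive fun p x => {f p x} := by
  classical
  refine (computablePred_iff_computable_decide.2 ?_ :
    ComputablePred fun q : P × U × U => q.2.2 = f q.1 q.2.1).to_re
  exact (PrimrecPred.decide (Primrec.eq (α := U))).to_comp.comp
    ((Computable.snd.comp Computable.snd).pair
      (hf.comp Computable.fst (Computable.fst.comp Computable.snd)))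

namespace IsNondetEnumeration

variable {U : Type*} [Primcodable U] {ξ : U → U → Set U}

/-- Over a finite `U` every relation is recursive, so the diagonal function `x ↦ (ξ x x)ᶜ` would be
listed. -/
theorem infinite (hξ : IsNondetEnumeration ξ) : Infinite U := by
  by_contra h
  rw [not_infinite_iff_finite] at h
  obtain ⟨u, hu⟩ := hξ.exhaustive (fun x => {y | y ∉ ξ x x})
    (PrimrecPred.of_finite fun p : U × U => p.2 ∉ ξ p.1 p.1).computablePred.to_re
  have : u ∈ ξ u u ↔ u ∉ ξ u u := by
    conv_lhs => rw [hu]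
    rfl
  tauto

/-- The parameter property for parameters that are coded by tuples. -/
theorem smn_of_leftInverse (hξ : IsNondetEnumeration ξ) {P : Type*} [Primcodable P] {n : ℕ}
    {dec : (Fin n → U) → P} {enc : P → Fin n → U} (hdec : Computable dec) (henc : Computable enc)
    (h : Function.LeftInverse dec enc) {η : P → U → Set U}
    (hη : IsUniformlyNondetPartialRecursive η) :
    ∃ s : P → U, Computable s ∧ ∀ p, ξ (s p) = η p := by
  obtain ⟨s, hs, hsη⟩ := hξ.smn n (fun z => η (dec z))
    (REPred.comp hη ((hdec.comp Computable.fst).pair Computable.snd))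
  exact ⟨fun p => s (enc p), hs.comp henc, fun p => by rw [hsη, h p]⟩

theorem smn_one (hξ : IsNondetEnumeration ξ) {η : U → U → Set U}
    (hη : IsUniformlyNondetPartialRecursive η) :
    ∃ s : U → U, Computable s ∧ ∀ z, ξ (s z) = η z :=
  hξ.smn_of_leftInverse (n := 1) (dec := fun z => z 0) (enc := fun u _ => u)
    (Computable.fin_app.comp Computable.id (Computable.const 0))
    (Computable.fin_pi fun _ => Computable.id) (fun _ => rfl) hη

theorem smn_cons (hξ : IsNondetEnumeration ξ) {n : ℕ} {η : U × (Fin n → U) → U → Set U}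
    (hη : IsUniformlyNondetPartialRecursive η) :
    ∃ s : U × (Fin n → U) → U, Computable s ∧ ∀ z, ξ (s z) = η z := by
  refine hξ.smn_of_leftInverse (n := n + 1) (dec := fun z => (z 0, fun i => z i.succ))
    (enc := fun p => Fin.cons p.1 p.2) ?_ ?_ (fun _ => by simp) hη
  · exact (Computable.fin_app.comp Computable.id (Computable.const 0)).pair
      (Computable.fin_pi fun i => Computable.fin_app.comp Computable.id (Computable.const i.succ))
  · refine Computable.fin_pi (f := fun i (p : U × (Fin n → U)) =>
      (Fin.cons p.1 p.2 : Fin (n + 1) → U) i) fun i => ?_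
    cases i using Fin.cases with
    | zero => simpa using Computable.fst
    | succ i => simpa using Computable.fin_app.comp Computable.snd (Computable.const i)

theorem smn_two (hξ : IsNondetEnumeration ξ) {η : U × U → U → Set U}
    (hη : IsUniformlyNondetPartialRecursive η) :
    ∃ s : U × U → U, Computable s ∧ ∀ z, ξ (s z) = η z :=
  hξ.smn_of_leftInverse (n := 2) (dec := fun z => (z 0, z 1))
    (enc := fun p i => Fin.cases p.1 (fun _ => p.2) i)
    ((Computable.fin_app.comp Computable.id (Computable.const 0)).pair
      (Computable.fin_app.comp Computable.id (Computable.const 1)))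
    (Computable.fin_pi fun i => by
      cases i using Fin.cases with
      | zero => exact Computable.fst
      | succ i => exact Computable.snd)
    (fun _ => rfl) hη

/-- Running, on the second argument, any program that is computed from the parameter. -/
theorem isUniformlyNondetPartialRecursive_biUnion (hξ : IsNondetEnumeration ξ) :
    IsUniformlyNondetPartialRecursive fun (p : U × U) y => ⋃ t ∈ ξ p.1 p.2, ξ t y := by
  have h : REPred fun x : ((U × U) × U × U) × U =>
      x.2 ∈ ξ x.1.1.1 x.1.1.2 ∧ x.1.2.2 ∈ ξ x.2 x.1.2.1 := by
    refine REPred.and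
      (REPred.comp hξ.universal (f := fun x : ((U × U) × U × U) × U =>
        (x.1.1.1, x.1.1.2, x.2)) ?_)
      (REPred.comp hξ.universal (f := fun x : ((U × U) × U × U) × U =>
        (x.2, x.1.2.1, x.1.2.2)) ?_)
    · exact (Computable.fst.comp (Computable.fst.comp Computable.fst)).pair
        ((Computable.snd.comp (Computable.fst.comp Computable.fst)).pair Computable.snd)
    · exact Computable.snd.pair (Computable.snd.comp Computable.fst)
  exact (REPred.exists_right (p := fun (x : (U × U) × U × U) (t : U) =>
    t ∈ ξ x.1.1 x.1.2 ∧ x.2.2 ∈ ξ t x.2.1) h).of_eq fun x => by simp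

/-- Kleene's recursion theorem. -/
theorem exists_fixedPoint (hξ : IsNondetEnumeration ξ) {F : U → U} (hF : Computable F) :
    ∃ e, ξ e = ξ (F e) := by
  -- `D z` runs whatever program `z` returns on itself; the fixed point is `D` at a code of `F ∘ D`.
  obtain ⟨D, hD, hDξ⟩ := hξ.smn_one (η := fun z y => ⋃ t ∈ ξ z z, ξ t y)
    (REPred.comp hξ.isUniformlyNondetPartialRecursive_biUnion
      (f := fun x : U × U × U => ((x.1, x.1), x.2))
      ((Computable.fst.pair Computable.fst).pair Computable.snd))
  obtain ⟨s, -, hs⟩ := hξ.smn_one (isUniformlyNondetPartialRecursive_singleton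
    (f := fun _ x => F (D x)) ((hF.comp hD).comp Computable.snd).to₂)
  have := hξ.infinite
  obtain ⟨u⟩ : Nonempty U := inferInstance
  refine ⟨D (s u), ?_⟩
  rw [hDξ, hs]
  simp

/-- The simultaneous recursion theorem for finitely many programs. -/
theorem exists_fixedPoint_pi (hξ : IsNondetEnumeration ξ) {n : ℕ} (c : Fin n → U)
    {s : U × (Fin n → U) → U} (hs : Computable s) :
    ∃ r : Fin n → U, ∀ i, ξ (r i) = ξ (s (c i, r)) := by
  -- One self-referential `e` suffices: on a label `x` it returns `s` at `x` and the tuple of all `q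
  -- (e, c i)`, and `q (e, c i)` runs what `e` returns on `c i`.
  obtain ⟨q, hq, hqξ⟩ := hξ.smn_two hξ.isUniformlyNondetPartialRecursive_biUnion
  obtain ⟨F, hF, hFξ⟩ := hξ.smn_one (isUniformlyNondetPartialRecursive_singleton
    (f := fun e x => s (x, fun i => q (e, c i)))
    (hs.comp (Computable.snd.pair (Computable.fin_pi fun i =>
      hq.comp (Computable.fst.pair (Computable.const (c i)))))).to₂)
  obtain ⟨e, he⟩ := hξ.exists_fixedPoint hF
  refine ⟨fun i => q (e, c i), fun i => ?_⟩
  rw [hqξ, he, hFξ]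
  simp

/-- Every finite ternary relation is realized by distinct programs. -/
theorem exists_realization (hξ : IsNondetEnumeration ξ) {n : ℕ}
    (step : Fin n → Fin n → Fin n → Prop) :
    ∃ r : Fin n → U, Function.Injective r ∧
      ∀ i y, ξ (r i) y = {y' | ∃ a v, step i a v ∧ y = r a ∧ y' = r v} := by
  have := hξ.infinite
  let c : Fin n ↪ U := Fin.valEmbedding.trans (Infinite.natEmbedding U)
  -- The second alternative exists only to force injectivity: a tuple with repetitions would consist
  -- of programs with distinct constant values `c i`.
  let η : U × (Fin n → U) → U → Set U := fun p y => {y' | ∃ i, p.1 = c i ∧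
    ((Function.Injective p.2 ∧ ∃ a v, step i a v ∧ y = p.2 a ∧ y' = p.2 v) ∨
      (¬ Function.Injective p.2 ∧ y' = c i))}
  have hη : IsUniformlyNondetPartialRecursive η := by
    have app : ∀ {α : Type _} [Primcodable α] {f : α → Fin n → U} {g : α → Fin n},
        Primrec f → Primrec g → Primrec fun a => f a (g a) :=
      fun hf hg => Primrec.fin_app.comp hf hg
    have inj : PrimrecPred fun r : Fin n → U => Function.Injective r :=
      ((PrimrecPred.forall_fin (p := fun (r : Fin n → U) a => ∀ b, ¬ (r a = r b ∧ a ≠ b))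
        (PrimrecPred.forall_fin (p := fun (x : (Fin n → U) × Fin n) b =>
            ¬ (x.1 x.2 = x.1 b ∧ x.2 ≠ b))
          (((Primrec.eq (α := U)).comp
            (app (Primrec.fst.comp Primrec.fst) (Primrec.snd.comp Primrec.fst))
            (app (Primrec.fst.comp Primrec.fst) Primrec.snd)).and
            ((Primrec.eq (α := Fin n)).comp
              (Primrec.snd.comp Primrec.fst) Primrec.snd).not).not))).of_eq fun r => by
        simp only [Function.Injective, not_and, not_not]
    have realized : PrimrecPred fun x : ((U × (Fin n → U)) × U × U) × Fin n =>
        ∃ a v, step x.2 a v ∧ x.1.2.1 = x.1.1.2 a ∧ x.1.2.2 = x.1.1.2 v := by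
      refine PrimrecPred.exists_fin (PrimrecPred.exists_fin
        (p := fun (z : (((U × (Fin n → U)) × U × U) × Fin n) × Fin n) v =>
          step z.1.2 z.2 v ∧ z.1.1.2.1 = z.1.1.1.2 z.2 ∧ z.1.1.2.2 = z.1.1.1.2 v) ?_)
      have fst₃ := Primrec.fst (α := (U × (Fin n → U)) × U × U) (β := Fin n)
        |>.comp ((Primrec.fst (β := Fin n)).comp (Primrec.fst (β := Fin n)))
      have tuple := Primrec.snd.comp (Primrec.fst.comp fst₃)
      refine PrimrecPred.and ?_ (PrimrecPred.and ?_ ?_)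
      · exact PrimrecPred.comp
          (PrimrecPred.of_finite fun t : Fin n × Fin n × Fin n => step t.1 t.2.1 t.2.2)
          ((Primrec.snd.comp (Primrec.fst.comp Primrec.fst)).pair
            ((Primrec.snd.comp Primrec.fst).pair Primrec.snd))
      · exact (Primrec.eq (α := U)).comp (Primrec.fst.comp (Primrec.snd.comp fst₃))
          (app tuple (Primrec.snd.comp Primrec.fst))
      · exact (Primrec.eq (α := U)).comp (Primrec.snd.comp (Primrec.snd.comp fst₃))
          (app tuple Primrec.snd)
    have const : Primrec fun x : ((U × (Fin n → U)) × U × U) × Fin n => c x.2 :=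
      (Primrec.dom_finite c).comp Primrec.snd
    have inj' : PrimrecPred fun x : ((U × (Fin n → U)) × U × U) × Fin n =>
        Function.Injective x.1.1.2 :=
      inj.comp (Primrec.snd.comp (Primrec.fst.comp Primrec.fst))
    refine (PrimrecPred.exists_fin (PrimrecPred.and ?_
      ((inj'.and realized).or (inj'.not.and ?_)))).computablePred.to_re
    · exact (Primrec.eq (α := U)).comp (Primrec.fst.comp (Primrec.fst.comp Primrec.fst)) const
    · exact (Primrec.eq (α := U)).comp (Primrec.snd.comp (Primrec.snd.comp Primrec.fst)) const
  obtain ⟨s, hs, hsξ⟩ := hξ.smn_cons hη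
  obtain ⟨r, hr⟩ := hξ.exists_fixedPoint_pi c hs
  simp only [hsξ] at hr
  have inj : Function.Injective r := by
    by_contra h
    have hc : ∀ i y, ξ (r i) y = {c i} := fun i y => by
      ext y'
      simp [hr, η, h]
    refine h fun i j hij => ?_
    have := hc i (r i)
    rw [hij, hc] at this
    simpa using this.symm
  refine ⟨r, inj, fun i y => ?_⟩
  ext y'
  simp [hr, η, inj]

end IsNondetEnumeration

/-! ### Soundness -/

namespace ModalFormula

theorem Provable.isTautologyOf {U : Type*} (ξ : U → U → Set U) {φ : ModalFormula}
    (h : Provable φ) : IsTautologyOf ξ φ := by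
  intro V
  rw [Set.eq_univ_iff_forall]
  induction h with
  | impK φ ψ => intro w; simp only [interp, Set.mem_union, Set.mem_compl_iff]; tauto
  | impS φ ψ χ => intro w; simp only [interp, Set.mem_union, Set.mem_compl_iff]; tauto
  | dne φ => intro w; simp only [neg, interp, Set.mem_union, Set.mem_compl_iff]; tauto
  | a1 φ ψ χ =>
    intro w
    by_contra h
    simp only [or, neg, interp, Set.mem_union, Set.mem_compl_iff, Set.mem_ofPred_eq,
      Set.mem_empty_iff_false, or_false, not_not, not_or] at h
    obtain ⟨h₁, h₂, h₃⟩ := h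
    exact h₃ fun u hu hne => hu.elim (fun hu => h₁ u hu hne) fun hu => h₂ u hu hne
  | a2 φ => intro w u hu; exact hu.elim
  | a3 φ => intro w u _ hne; simpa [top, neg, interp] using hne
  | mp _ _ ih₁ ih₂ => intro w; exact (ih₁ w).elim (fun h => (h (ih₂ w)).elim) id
  | mono _ _ ih₁ ih₂ =>
    intro w
    refine or_iff_not_imp_left.2 fun h u hu hne => ?_
    obtain ⟨y, hy, hy'⟩ := not_not.1 h u ((ih₁ u).resolve_left (not_not.2 hu)) hne
    exact ⟨y, hy, (ih₂ y).resolve_left (not_not.2 hy')⟩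

/-! ### Kripke models inside an enumeration -/

theorem IsTautologyOf.forces {U : Type*} [Primcodable U] {ξ : U → U → Set U}
    (hξ : IsNondetEnumeration ξ) {φ : ModalFormula} (h : IsTautologyOf ξ φ)
    (K : KripkeModel) (w : K.World) : K.Forces w φ := by
  have := K.finite_world
  obtain ⟨n, ⟨e⟩⟩ := Finite.exists_equiv_fin K.World
  obtain ⟨r, hr, hrξ⟩ := hξ.exists_realization
    fun i a v => K.step (e.symm i) (e.symm a) (e.symm v)
  let code : K.World → U := fun w => r (e w)
  have code_inj : Function.Injective code := hr.comp e.injective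
  have hcode : ∀ w y, ξ (code w) y = {y' | ∃ a v, K.step w a v ∧ y = code a ∧ y' = code v} := by
    intro w y
    ext y'
    simp only [code, hrξ, Set.mem_ofPred_eq, e.symm_apply_apply]
    constructor
    · rintro ⟨a, v, h⟩
      exact ⟨e.symm a, e.symm v, by simpa using h⟩
    · rintro ⟨a, v, h⟩
      exact ⟨e a, e v, by simpa using h⟩
  let V : ℕ → Set U := fun p => code '' {w | K.forcesVar w p}
  suffices H : ∀ (φ : ModalFormula) (w : K.World), code w ∈ interp ξ V φ ↔ K.Forces w φ by
    rw [← H, h V]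
    exact Set.mem_univ _
  intro φ
  induction φ with
  | var p => exact fun w => code_inj.mem_set_image
  | bot => exact fun w => Iff.rfl
  | imp φ ψ ih₁ ih₂ =>
    intro w
    simp only [interp, KripkeModel.Forces, Set.mem_union, Set.mem_compl_iff, ih₁, ih₂]
  | rhd φ ψ ih₁ ih₂ =>
    intro w
    constructor
    · intro hw u v huv hu
      obtain ⟨y, hy, hyψ⟩ := hw (code u) ((ih₁ u).2 hu)
        ⟨code v, by rw [hcode]; exact ⟨u, v, huv, rfl, rfl⟩⟩
      rw [hcode] at hy
      obtain ⟨a, v', hav, ha, rfl⟩ := hy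
      -- Distinctness of the codes recovers the input world.
      obtain rfl := code_inj ha
      exact ⟨v', hav, (ih₂ v').1 hyψ⟩
    · rintro hw y hy ⟨y', hy'⟩
      -- Convergence forces the input `y` to be a code.
      rw [hcode] at hy'
      obtain ⟨u, v, huv, rfl, rfl⟩ := hy'
      obtain ⟨v', huv', hv'⟩ := hw u v huv ((ih₁ u).1 hy)
      exact ⟨code v', by rw [hcode]; exact ⟨u, v', huv', rfl, rfl⟩, (ih₂ v').2 hv'⟩

/-! ### Derivations from hypotheses -/

/-- Derivability from a set of hypotheses by modus ponens and the theorems of `ℜ`. -/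
inductive Derivable (Γ : Set ModalFormula) : ModalFormula → Prop
  | hyp {φ : ModalFormula} : φ ∈ Γ → Derivable Γ φ
  | thm {φ : ModalFormula} : Provable φ → Derivable Γ φ
  | mp {φ ψ : ModalFormula} : Derivable Γ (imp φ ψ) → Derivable Γ φ → Derivable Γ ψ

namespace Derivable

variable {Γ Δ : Set ModalFormula} {φ ψ χ : ModalFormula}

theorem weaken (h : Derivable Γ φ) (hΓ : Γ ⊆ Δ) : Derivable Δ φ := by
  induction h with
  | hyp h => exact hyp (hΓ h)
  | thm h => exact thm h
  | mp _ _ ih₁ ih₂ => exact mp ih₁ ih₂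

theorem provable (h : Derivable ∅ φ) : Provable φ := by
  induction h with
  | hyp h => exact h.elim
  | thm h => exact h
  | mp _ _ ih₁ ih₂ => exact .mp ih₁ ih₂

/-- Rule M enters only through `thm`, so modus ponens is the only rule applied to hypotheses. -/
theorem deduction (h : Derivable (insert φ Γ) ψ) : Derivable Γ (imp φ ψ) := by
  induction h with
  | @hyp ψ h =>
    obtain rfl | h := h
    · exact thm (.mp (.mp (.impS ψ (imp ψ ψ) ψ) (.impK _ _)) (.impK _ _))
    · exact mp (thm (.impK _ _)) (hyp h)
  | thm h => exact mp (thm (.impK _ _)) (thm h)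
  | mp _ _ ih₁ ih₂ => exact mp (mp (thm (.impS _ _ _)) ih₁) ih₂

theorem by_contradiction (h : Derivable (insert (neg φ) Γ) bot) : Derivable Γ φ :=
  mp (thm (.dne φ)) h.deduction

theorem exfalso (h : Derivable Γ bot) : Derivable Γ φ :=
  by_contradiction (h.weaken (Set.subset_insert _ _))

theorem head : Derivable (insert φ Γ) φ := hyp (Set.mem_insert _ _)

theorem lift (h : Derivable Γ φ) : Derivable (insert ψ Γ) φ := h.weaken (Set.subset_insert _ _)

theorem exists_of_sUnion {c : Set (Set ModalFormula)} (hc : IsChain (· ⊆ ·) c) (hne : c.Nonempty)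
    (h : Derivable (⋃₀ c) φ) : ∃ Γ ∈ c, Derivable Γ φ := by
  induction h with
  | hyp h =>
    obtain ⟨Γ, hΓ, h⟩ := h
    exact ⟨Γ, hΓ, hyp h⟩
  | thm h => exact hne.imp fun Γ hΓ => ⟨hΓ, thm h⟩
  | mp _ _ ih₁ ih₂ =>
    obtain ⟨Γ, hΓ, h₁⟩ := ih₁
    obtain ⟨Δ, hΔ, h₂⟩ := ih₂
    obtain h | h := hc.total hΓ hΔ
    · exact ⟨Δ, hΔ, mp (h₁.weaken h) h₂⟩
    · exact ⟨Γ, hΓ, mp h₁ (h₂.weaken h)⟩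

end Derivable

open Derivable in
theorem Provable.neg_or_left (φ ψ : ModalFormula) : Provable (imp (neg (or φ ψ)) (neg φ)) :=
  provable <| deduction <| deduction <|
    Derivable.mp head.lift (deduction (exfalso (Derivable.mp head head.lift)))

open Derivable in
theorem Provable.neg_or_right (φ ψ : ModalFormula) : Provable (imp (neg (or φ ψ)) (neg ψ)) :=
  provable <| deduction <| deduction <| Derivable.mp head.lift (deduction head.lift)

open Derivable in
theorem Provable.of_neg_imp_neg {φ ψ : ModalFormula} (h : Provable (imp (neg ψ) (neg φ))) :
    Provable (imp φ ψ) :=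
  provable <| deduction <| by_contradiction <| Derivable.mp (Derivable.mp (thm h) head) head.lift

/-- A maximal consistent set of formulas. -/
def IsMaximalConsistent (M : Set ModalFormula) : Prop :=
  ¬ Derivable M bot ∧ ∀ φ, φ ∈ M ∨ neg φ ∈ M

/-! ### Maximal consistent sets and the ideals given by `rhd` -/

namespace IsMaximalConsistent

variable {M : Set ModalFormula} {φ ψ χ : ModalFormula}

theorem mem_of_derivable (hM : IsMaximalConsistent M) (h : Derivable M φ) : φ ∈ M :=
  (hM.2 φ).resolve_right fun h' => hM.1 (.mp (.hyp h') h)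

theorem mem_mp (hM : IsMaximalConsistent M) (h : Provable (imp φ ψ)) (hφ : φ ∈ M) : ψ ∈ M :=
  hM.mem_of_derivable (.mp (.thm h) (.hyp hφ))

theorem neg_mem_iff (hM : IsMaximalConsistent M) : neg φ ∈ M ↔ φ ∉ M :=
  ⟨fun h h' => hM.1 (.mp (.hyp h) (.hyp h')), (hM.2 φ).resolve_left⟩

theorem bot_notMem (hM : IsMaximalConsistent M) : bot ∉ M := fun h => hM.1 (.hyp h)

theorem imp_mem_iff (hM : IsMaximalConsistent M) : imp φ ψ ∈ M ↔ φ ∉ M ∨ ψ ∈ M := by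
  constructor
  · intro h
    by_cases hφ : φ ∈ M
    · exact Or.inr (hM.mem_of_derivable (.mp (.hyp h) (.hyp hφ)))
    · exact Or.inl hφ
  · rintro (h | h)
    · exact hM.mem_of_derivable
        (Derivable.mp (Derivable.hyp (hM.neg_mem_iff.2 h)).lift .head).exfalso.deduction
    · exact hM.mem_of_derivable (Derivable.hyp h).lift.deduction

/-- Lindenbaum's lemma. -/
theorem exists_superset {Γ : Set ModalFormula} (hΓ : ¬ Derivable Γ bot) :
    ∃ M, Γ ⊆ M ∧ IsMaximalConsistent M := by
  obtain ⟨M, hΓM, hM⟩ := zorn_subset_nonempty {M | ¬ Derivable M bot}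
    (fun c hc hchain hne => ⟨⋃₀ c, fun h => by
      obtain ⟨Δ, hΔ, h⟩ := h.exists_of_sUnion hchain hne
      exact hc hΔ h, fun s hs => Set.subset_sUnion_of_mem hs⟩) Γ hΓ
  refine ⟨M, hΓM, hM.prop, fun φ => ?_⟩
  by_contra! h
  have key : ∀ ψ, ψ ∉ M → Derivable (insert ψ M) bot := fun ψ hψ => by
    by_contra hc
    exact hψ (hM.le_of_ge hc (Set.subset_insert _ _) (Set.mem_insert _ _))
  exact hM.prop (.mp (key _ h.2).deduction (key _ h.1).deduction)

theorem exists_mem_notMem (h : ¬ Provable (imp φ ψ)) :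
    ∃ M, IsMaximalConsistent M ∧ φ ∈ M ∧ ψ ∉ M := by
  obtain ⟨M, hM, hMC⟩ := exists_superset (Γ := insert (neg ψ) {φ}) fun h' =>
    h ((h'.by_contradiction.weaken (by simp)).deduction (Γ := ∅)).provable
  exact ⟨M, hMC, hM (by simp), hMC.neg_mem_iff.1 (hM (by simp))⟩

theorem exists_notMem (h : ¬ Provable ψ) : ∃ M, IsMaximalConsistent M ∧ ψ ∉ M := by
  obtain ⟨M, hM, -, h⟩ := exists_mem_notMem (φ := top) (ψ := ψ) fun h' =>
    h (h'.mp (Derivable.provable (Derivable.head.deduction)))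
  exact ⟨M, hM, h⟩

theorem rhd_mem_mono (hM : IsMaximalConsistent M) (h : Provable (imp φ χ)) (hχ : rhd χ ψ ∈ M) :
    rhd φ ψ ∈ M :=
  hM.mem_mp (.mono h (Derivable.provable Derivable.head.deduction)) hχ

/-- The antecedents `χ` of the formulas `χ ▷ ψ` in `M` form an ideal. -/
theorem exists_rhd_mem_of_derivable (hM : IsMaximalConsistent M)
    (h : Derivable (neg '' {χ | rhd χ ψ ∈ M}) φ) :
    ∃ χ, rhd χ ψ ∈ M ∧ Provable (imp (neg χ) φ) := by
  induction h with
  | hyp h =>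
    obtain ⟨χ, hχ, rfl⟩ := h
    exact ⟨χ, hχ, Derivable.head.deduction (Γ := ∅) |>.provable⟩
  | thm h => exact ⟨bot, hM.mem_of_derivable (.thm (.a2 ψ)), .mp (.impK _ _) h⟩
  | mp _ _ ih₁ ih₂ =>
    obtain ⟨χ₁, h₁, h₁'⟩ := ih₁
    obtain ⟨χ₂, h₂, h₂'⟩ := ih₂
    refine ⟨or χ₁ χ₂, hM.mem_of_derivable (.mp (.mp (.thm (.a1 _ _ _)) (.hyp h₁)) (.hyp h₂)), ?_⟩
    exact Derivable.provable (Derivable.deduction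
      (.mp (.mp (.thm h₁') (.mp (.thm (.neg_or_left _ _)) .head))
        (.mp (.thm h₂') (.mp (.thm (.neg_or_right _ _)) .head))))

/-- If the required set were inconsistent, `φ` would provably imply a member of the ideal, and M
would put `φ ▷ ψ` in `M`. -/
theorem exists_of_rhd_notMem (hM : IsMaximalConsistent M) (h : rhd φ ψ ∉ M) :
    ∃ N, IsMaximalConsistent N ∧ φ ∈ N ∧ ∀ χ, rhd χ ψ ∈ M → χ ∉ N := by
  obtain ⟨N, hN, hNC⟩ := exists_superset (Γ := insert φ (neg '' {χ | rhd χ ψ ∈ M})) fun h' => by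
    obtain ⟨χ, hχ, hφ⟩ := hM.exists_rhd_mem_of_derivable h'.deduction
    exact h (hM.rhd_mem_mono (.of_neg_imp_neg hφ) hχ)
  exact ⟨N, hNC, hN (Set.mem_insert _ _), fun χ hχ =>
    hNC.neg_mem_iff.1 (hN (Set.mem_insert_of_mem _ ⟨χ, hχ, rfl⟩))⟩

end IsMaximalConsistent

/-! ### Completeness for finite Kripke models -/

/-- The set of subformulas of a formula. -/
def subformulas : ModalFormula → Set ModalFormula
  | var p => {var p}
  | bot => {bot}
  | imp φ ψ => insert (imp φ ψ) (subformulas φ ∪ subformulas ψ)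
  | rhd φ ψ => insert (rhd φ ψ) (subformulas φ ∪ subformulas ψ)

theorem finite_subformulas (φ : ModalFormula) : (subformulas φ).Finite := by
  induction φ with
  | var p => exact Set.finite_singleton _
  | bot => exact Set.finite_singleton _
  | imp φ ψ ih₁ ih₂ => exact (ih₁.union ih₂).insert _
  | rhd φ ψ ih₁ ih₂ => exact (ih₁.union ih₂).insert _

theorem self_mem_subformulas (φ : ModalFormula) : φ ∈ subformulas φ := by
  cases φ <;> simp [subformulas]

theorem subformulas_subset {φ χ : ModalFormula} (h : φ ∈ subformulas χ) :
    subformulas φ ⊆ subformulas χ := by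
  induction χ with
  | var p => obtain rfl : φ = _ := h; exact subset_rfl
  | bot => obtain rfl : φ = _ := h; exact subset_rfl
  | imp χ₁ χ₂ ih₁ ih₂ =>
    obtain rfl | h | h := h
    · exact subset_rfl
    · exact (ih₁ h).trans (Set.subset_union_left.trans (Set.subset_insert _ _))
    · exact (ih₂ h).trans (Set.subset_union_right.trans (Set.subset_insert _ _))
  | rhd χ₁ χ₂ ih₁ ih₂ =>
    obtain rfl | h | h := h
    · exact subset_rfl
    · exact (ih₁ h).trans (Set.subset_union_left.trans (Set.subset_insert _ _))
    · exact (ih₂ h).trans (Set.subset_union_right.trans (Set.subset_insert _ _))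

/-- The worlds of the canonical model for the subformulas of `θ`: the traces of the maximal
consistent sets, each in one copy for every subformula of `θ`. -/
def CanonicalWorld (θ : ModalFormula) : Type :=
  {S : Set (subformulas θ) // ∃ M, IsMaximalConsistent M ∧ S = {φ | φ.1 ∈ M}} × subformulas θ

namespace CanonicalWorld

variable {θ : ModalFormula}

/-- A maximal consistent set with the trace `w`. -/
def theory (w : CanonicalWorld θ) : Set ModalFormula := w.1.2.choose

/-- The formula that the values computed from an input at `w` avoid. -/
def avoided (w : CanonicalWorld θ) : ModalFormula := w.2.1

theorem isMaximalConsistent (w : CanonicalWorld θ) : IsMaximalConsistent w.theory :=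
  w.1.2.choose_spec.1

/-- `theory` is chosen from the trace alone, so it agrees with `N` only on subformulas of `θ`. -/
theorem exists_theory_eq {N : Set ModalFormula} (hN : IsMaximalConsistent N) {ψ : ModalFormula}
    (hψ : ψ ∈ subformulas θ) :
    ∃ w : CanonicalWorld θ, w.avoided = ψ ∧ ∀ φ ∈ subformulas θ, φ ∈ w.theory ↔ φ ∈ N := by
  refine ⟨⟨⟨{φ | φ.1 ∈ N}, N, hN, rfl⟩, ⟨ψ, hψ⟩⟩, rfl, fun φ hφ => ?_⟩
  have h : ∃ M, IsMaximalConsistent M ∧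
      ({φ | φ.1 ∈ N} : Set (subformulas θ)) = {φ | φ.1 ∈ M} := ⟨N, hN, rfl⟩
  exact (Set.ext_iff.1 h.choose_spec.2 ⟨φ, hφ⟩).symm

instance : Finite (CanonicalWorld θ) := by
  have : Finite (subformulas θ) := finite_subformulas θ
  unfold CanonicalWorld
  infer_instance

end CanonicalWorld

/-- The canonical model for the subformulas of `θ`. -/
def canonicalModel (θ : ModalFormula) : KripkeModel where
  World := CanonicalWorld θ
  finite_world := inferInstance
  -- On input `u`, `w` returns every world avoiding `u.avoided` if these meet all demands of `w`,
  -- and diverges otherwise. The second conjunct does not depend on `v`.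
  step w u v := u.avoided ∉ v.theory ∧ ∀ φ ψ, rhd φ ψ ∈ subformulas θ → rhd φ ψ ∈ w.theory →
    φ ∈ u.theory → ∃ v' : CanonicalWorld θ, u.avoided ∉ v'.theory ∧ ψ ∈ v'.theory
  forcesVar w p := var p ∈ w.theory

theorem canonicalModel_forces_iff {θ φ : ModalFormula} (hφ : φ ∈ subformulas θ)
    (w : CanonicalWorld θ) : (canonicalModel θ).Forces w φ ↔ φ ∈ w.theory := by
  induction φ generalizing w with
  | var p => exact Iff.rfl
  | bot => exact iff_of_false id w.isMaximalConsistent.bot_notMem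
  | imp φ ψ ih₁ ih₂ =>
    have hsub := subformulas_subset hφ
    have hφ' := hsub (Or.inr (Or.inl (self_mem_subformulas φ)))
    have hψ' := hsub (Or.inr (Or.inr (self_mem_subformulas ψ)))
    rw [w.isMaximalConsistent.imp_mem_iff, ← ih₁ hφ', ← ih₂ hψ']
    exact Iff.rfl
  | rhd φ ψ ih₁ ih₂ =>
    have hsub := subformulas_subset hφ
    have hφ' := hsub (Or.inr (Or.inl (self_mem_subformulas φ)))
    have hψ' := hsub (Or.inr (Or.inr (self_mem_subformulas ψ)))
    have hM := w.isMaximalConsistent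
    constructor
    · intro hw
      by_contra h
      obtain ⟨N, hN, hφN, hNψ⟩ := hM.exists_of_rhd_notMem h
      obtain ⟨u, hu, huN⟩ := CanonicalWorld.exists_theory_eq hN hψ'
      -- A3 is what guarantees a value avoiding `ψ`: with `ψ` provable, `φ ▷ ⊤` would give `φ ▷ ψ`.
      have hψ : ¬ Provable ψ := fun hψ =>
        h (hM.mem_mp (.mono (Derivable.provable Derivable.head.deduction) (.mp (.impK _ _) hψ))
          (hM.mem_of_derivable (.thm (.a3 φ))))
      obtain ⟨N', hN', hψN'⟩ := IsMaximalConsistent.exists_notMem hψ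
      obtain ⟨v, -, hv⟩ := CanonicalWorld.exists_theory_eq hN' hψ'
      obtain ⟨v', huv', hv'⟩ := hw u v (by
        refine ⟨by rwa [hu, hv ψ hψ'], fun α β hαβ hαβw hαu => ?_⟩
        have hsub' := subformulas_subset hαβ
        have hα := hsub' (Or.inr (Or.inl (self_mem_subformulas α)))
        have hβ := hsub' (Or.inr (Or.inr (self_mem_subformulas β)))
        -- Otherwise `α ▷ β` would give `α ▷ ψ`, placing `α` in the ideal that `N` misses.
        have hβψ : ¬ Provable (imp β ψ) := fun hβψ =>
          hNψ α (hM.mem_mp (.mono (Derivable.provable Derivable.head.deduction) hβψ) hαβw)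
            ((huN α hα).1 hαu)
        obtain ⟨L, hL, hβL, hψL⟩ := IsMaximalConsistent.exists_mem_notMem hβψ
        obtain ⟨v', -, hv'⟩ := CanonicalWorld.exists_theory_eq hL hψ'
        exact ⟨v', by rwa [hu, hv' ψ hψ'], (hv' β hβ).2 hβL⟩)
        ((ih₁ hφ' u).2 ((huN φ hφ').2 hφN))
      exact huv'.1 (hu ▸ (ih₂ hψ' v').1 hv')
    · rintro hw u v ⟨-, huv⟩ hu
      obtain ⟨v', hv', hψv'⟩ := huv φ ψ hφ hw ((ih₁ hφ' u).1 hu)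
      exact ⟨v', ⟨hv', huv⟩, (ih₂ hψ' v').2 hψv'⟩

theorem provable_of_forces {φ : ModalFormula}
    (h : ∀ (K : KripkeModel) (w : K.World), K.Forces w φ) : Provable φ := by
  by_contra hφ
  obtain ⟨M, hM, hφM⟩ := IsMaximalConsistent.exists_notMem hφ
  have hself := self_mem_subformulas φ
  obtain ⟨w, -, hw⟩ := CanonicalWorld.exists_theory_eq hM hself
  exact hφM ((hw φ hself).1 ((canonicalModel_forces_iff hself w).1 (h (canonicalModel φ) w)))

end ModalFormula

theorem mainTheorem1 {U : Type*} [Primcodable U] (ξ : U → U → Set U)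
    (hξ : IsNondetEnumeration ξ) (φ : ModalFormula) :
    List.TFAE [
      ModalFormula.IsTautologyOf ξ φ,
      ∀ (K : KripkeModel) (w : K.World), K.Forces w φ,
      ModalFormula.Provable φ] := by
  tfae_have 1 → 2 := fun h => h.forces hξ
  tfae_have 2 → 3 := ModalFormula.provable_of_forces
  tfae_have 3 → 1 := fun h => h.isTautologyOf ξ
  tfae_finish
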